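/- Let $\mathcal X$ be a Polish space with its Borel $\sigma$-field, $\mu$ a Borel probability measure on $\mathcal X$, and $\Phi$ a set of bounded measurable functions $\varphi:\mathcal X\to\mathbb R$ that is symmetric ($\varphi\in\Phi\Rightarrow-\varphi\in\Phi$). Let $\alpha:[0,\infty)\to[0,\infty]$ be convex and lower semicontinuous with $\alpha(0)=0$, put $\alpha(+\infty):=\sup\alpha$, and let $\alpha^{\circledast}(s)=\sup_{t\ge0}\{st-\alpha(t)\}$, $s\ge 0$. Assume - $(A_1)$: $\{s\ge0:\alpha^{\circledast}(s)<\infty\}=[0,b)$ for some $b\in(0,+\infty]$; - $(A_2)$: there are $s_0>0$ and $c>0$ such that $\alpha^{\circledast}(s)\ge c\,s^2$ for all $s\in[0,s_0]$. Write $\langle\varphi,\mu\rangle=\int\varphi\,d\mu$ and, for a probability measure $\nu$, $\|\nu-\mu\|^*_\Phi=\sup_{\varphi\in\Phi}\{\int\varphi\,d\nu-\int\varphi\,d\mu\}\in[0,\infty]$ (equal to $0$ if $\Phi=\emptyset$). Let $H(\nu\mid\mu)=\int\log\frac{d\nu}{d\mu}\,d\nu$ if $\nu\ll\mu$ and $H(\nu\mid\mu)=+\infty$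 otherwise. Let $\tau_\alpha=e^{\alpha}-1$ and $\|f\|_{\tau_\alpha}=\inf\{\lambda>0:\int\tau_\alpha(|f|/\lambda)\,d\mu\le1\}$ (with $\inf\emptyset=+\infty$). Then the following are equivalent: 1. there is $a>0$ such that $\alpha\left(\|\nu-\mu\|^*_\Phi/a\right)\le H(\nu\mid\mu)$ for all Borel probability measures $\nu$ on $\mathcal X$; 2. there is $M>0$ such that $\|\varphi-\langle\varphi,\mu\rangle\|_{\tau_\alpha}\le M$ for all $\varphi\in\Phi$. More precisely, if (1) holds with a constant $a>0$, then (2) holds with $M=3a$. Conversely, if (2) holds with a constant $M>0$, then (1) holds with $a=\sqrt2\,m_\alpha M$, where $$m_\alpha=e\max\left(\frac{\alpha^{-1}(2)}{\sqrt{c\,(1-u)}},\ \frac1u\right),\qquad \alpha^{-1}(2)=\sup\{t\ge0:\alpha(t)\le2\},$$ for any $s_0,c>0$ as in $(A_2)$ and any $u\in(0,1)$ such that $\frac{u}{\sqrt{1-u}}\le s_0\sqrt{c}$ and $\frac{u^3}{1-u}\le2$. -/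

import Mathlib

open Set MeasureTheory
open scoped NNReal ENNReal

noncomputable section

namespace NormEntropy

/-- The class `𝒞` of convex lower semicontinuous functions `α : [0, ∞) → [0, ∞]` with `α 0 = 0`. -/
structure ClassC (α : ℝ≥0 → ℝ≥0∞) : Prop where
  convex : ConvexOn ℝ≥0 univ α
  lsc : LowerSemicontinuous α
  map_zero : α 0 = 0

/-- The value of `α` at a point of `[0, ∞]`, with `α(∞) = sup α`
(for `α` in `𝒞` this is the limit of `α` at infinity). -/
def extend (α : ℝ≥0 → ℝ≥0∞) (x : ℝ≥0∞) : ℝ≥0∞ :=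
  if x = ∞ then ⨆ t : ℝ≥0, α t else α x.toNNReal

/-- The monotone convex conjugate `s ↦ sup_{t ≥ 0} (s t - α t)`. The subtraction is the truncated
one of `[0, ∞]`; as the term for `t = 0` is `0` when `α 0 = 0`, the supremum is the usual one. -/
def conj (α : ℝ≥0 → ℝ≥0∞) (s : ℝ≥0) : ℝ≥0∞ :=
  ⨆ t : ℝ≥0, ((s * t : ℝ≥0) : ℝ≥0∞) - α t

/-- Assumption (A1): the effective domain of the conjugate is `[0, b)` for some `b ∈ (0, ∞]`. -/
def AssumptionA1 (α : ℝ≥0 → ℝ≥0∞) : Prop :=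
  ∃ b : ℝ≥0∞, 0 < b ∧ {s : ℝ≥0 | conj α s < ∞} = {s : ℝ≥0 | (s : ℝ≥0∞) < b}

/-- The conjugate of `α` is bounded below by `c s²` on `[0, s₀]`, where `s₀, c > 0`. -/
def SuperQuadratic (α : ℝ≥0 → ℝ≥0∞) (s₀ c : ℝ≥0) : Prop :=
  0 < s₀ ∧ 0 < c ∧ ∀ s : ℝ≥0, s ≤ s₀ → ((c * s ^ 2 : ℝ≥0) : ℝ≥0∞) ≤ conj α s

/-- Assumption (A2): the conjugate of `α` is super-quadratic near `0`. -/
def AssumptionA2 (α : ℝ≥0 → ℝ≥0∞) : Prop :=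
  ∃ s₀ c : ℝ≥0, SuperQuadratic α s₀ c

/-- The generalized inverse `α⁻¹(y) = sup {t ≥ 0 | α t ≤ y}`. The set is bounded for finite `y`
as soon as `α` is in `𝒞` and is not identically `0`, which follows from (A1). -/
def inverse (α : ℝ≥0 → ℝ≥0∞) (y : ℝ≥0∞) : ℝ≥0 :=
  sSup {t : ℝ≥0 | α t ≤ y}

/-- The Young function `τ_α = exp α - 1`. -/
def tau (α : ℝ≥0 → ℝ≥0∞) (t : ℝ≥0) : ℝ≥0∞ :=
  EReal.exp ((α t : ℝ≥0∞) : EReal) - 1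

variable {X : Type*} [MeasurableSpace X]

/-- The Luxemburg norm
`‖f‖_{τ_α} = inf {l > 0 | ∫ τ_α(|f| / l) dμ ≤ 1}`, equal to `∞` if there is no such `l`. -/
def luxemburgNorm (α : ℝ≥0 → ℝ≥0∞) (μ : Measure X) (f : X → ℝ) : ℝ≥0∞ :=
  ⨅ (l : ℝ≥0) (_ : 0 < l ∧ ∫⁻ x, tau α (‖f x‖₊ / l) ∂μ ≤ 1), (l : ℝ≥0∞)

/-- A symmetric class of bounded measurable functions. -/
structure IsSymmetricBoundedClass (Φ : Set (X → ℝ)) : Prop where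
  measurable : ∀ φ ∈ Φ, Measurable φ
  bounded : ∀ φ ∈ Φ, ∃ C : ℝ, ∀ x, |φ x| ≤ C
  symmetric : ∀ φ ∈ Φ, -φ ∈ Φ

/-- The semi-norm `‖ν - μ‖*_Φ = sup_{φ ∈ Φ} (∫ φ dν - ∫ φ dμ)`, with values in `[0, ∞]`.
Negative terms may be replaced by `0`, because `Φ` is symmetric. -/
def dualNorm (Φ : Set (X → ℝ)) (ν μ : Measure X) : ℝ≥0∞ :=
  ⨆ φ ∈ Φ, ENNReal.ofReal (∫ x, φ x ∂ν - ∫ x, φ x ∂μ)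

/-- The norm-entropy inequality `α(‖ν - μ‖*_Φ / a) ≤ H(ν | μ)` for all probability measures `ν`. -/
def NormEntropyInequality (α : ℝ≥0 → ℝ≥0∞) (Φ : Set (X → ℝ)) (μ : Measure X) (a : ℝ) : Prop :=
  ∀ ν : Measure X, IsProbabilityMeasure ν →
    extend α (dualNorm Φ ν μ / ENNReal.ofReal a) ≤ InformationTheory.klDiv ν μ

/-- `‖φ - ⟨φ, μ⟩‖_{τ_α} ≤ M` for all `φ ∈ Φ`. -/
def OrliczBound (α : ℝ≥0 → ℝ≥0∞) (Φ : Set (X → ℝ)) (μ : Measure X) (M : ℝ) : Prop :=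
  ∀ φ ∈ Φ, luxemburgNorm α μ (fun x => φ x - ∫ y, φ y ∂μ) ≤ ENNReal.ofReal M

/-- The constant `m_α = e max (α⁻¹(2) / √(c (1 - u)), 1 / u)`. -/
def mConst (α : ℝ≥0 → ℝ≥0∞) (c : ℝ≥0) (u : ℝ) : ℝ :=
  Real.exp 1 * max ((inverse α 2 : ℝ) / √((c : ℝ) * (1 - u))) (1 / u)

end NormEntropy

end

/-! From entropy to Orlicz: conditioning `μ` on an event of probability `p > 0` costs entropy at
most `-log p`. On the event `α((φ - ⟨φ, μ⟩)⁺ / a) > y` this forces `p ≤ exp (-y)`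
(`NormEntropyInequality.measureReal_le`). Passing from `a` to `3a` divides `α` by at least 3, so
`τ_α` gets the tail `2 (1 + z)⁻³`, whose integral is 1.

From Orlicz to entropy: take an affine minorant `r ↦ s r - A` of `α`, nearly tight at `t`. By
Donsker–Varadhan (`integral_le_klDiv_add_log`) it suffices that the centred, normalized variable `Y`
satisfies `∫ exp (s Y / K) dμ ≤ exp A` with `K = √2 m_α`; this is `integral_exp_mul_le`. Put `β =
α⁻¹(2)`. If `s β ≤ 3`, a second-order expansion has no linear term by centring, and (A2) makes `A`
dominate the remainder (`quadratic_le_of_intercept`). If `s β > 3`, then `A > 1`, and `s |Y| ≤ A +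
α(|Y|)` suffices. -/

noncomputable section

namespace NormEntropy

/-! ### Convexity: affine minorants, generalized inverse and conjugate. -/

section Convex

variable {α : ℝ≥0 → ℝ≥0∞}

theorem ClassC.map_mul_le (hα : ClassC α) {k : ℝ≥0} (hk : k ≤ 1) (t : ℝ≥0) :
    α (k * t) ≤ k * α t := by
  have h := hα.convex.2 (mem_univ t) (mem_univ 0) (zero_le (a := k)) (zero_le (a := 1 - k))
    (add_tsub_cancel_of_le hk)
  simpa [hα.map_zero, ENNReal.smul_def] using h

theorem ClassC.monotone (hα : ClassC α) : Monotone α := by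
  intro s t hst
  rcases eq_or_ne t 0 with rfl | ht
  · rw [le_antisymm hst zero_le]
  have hk : s / t ≤ 1 := div_le_one_of_le₀ hst zero_le
  have h := hα.map_mul_le hk t
  rw [div_mul_cancel₀ _ ht] at h
  refine h.trans (mul_le_of_le_one_left zero_le ?_)
  exact_mod_cast hk

theorem ClassC.isClosed_sublevel (hα : ClassC α) (y : ℝ≥0∞) : IsClosed {t | α t ≤ y} :=
  hα.lsc.isClosed_preimage y

theorem ClassC.toReal_mul_sub_le (hα : ClassC α) {p t r : ℝ≥0} (hpt : p < t) (htr : t < r)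
    (hr : α r ≠ ∞) :
    (α t).toReal * ((r : ℝ) - p) ≤ (r - t) * (α p).toReal + (t - p) * (α r).toReal := by
  have hpr : p < r := hpt.trans htr
  have hp : α p ≠ ∞ := ne_top_of_le_ne_top hr (hα.monotone hpr.le)
  have h1 : (p : ℝ) < t := hpt
  have h2 : (t : ℝ) < r := htr
  have hd : (0 : ℝ) < r - p := by linarith
  set k : ℝ≥0 := ⟨(r - t) / (r - p), by apply div_nonneg <;> linarith⟩ with hk
  set m : ℝ≥0 := ⟨(t - p) / (r - p), by apply div_nonneg <;> linarith⟩ with hm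
  have hkc : (k : ℝ) = (r - t) / (r - p) := rfl
  have hmc : (m : ℝ) = (t - p) / (r - p) := rfl
  have hkm : k + m = 1 := by
    apply NNReal.coe_injective
    push_cast
    rw [hkc, hmc]; field_simp; ring
  have h := hα.convex.2 (mem_univ p) (mem_univ r) (zero_le (a := k)) (zero_le (a := m)) hkm
  have hpoint : k • p + m • r = t := by
    apply NNReal.coe_injective
    simp only [smul_eq_mul]
    push_cast
    rw [hkc, hmc]; field_simp; ring
  rw [hpoint] at h
  have h' := ENNReal.toReal_mono (by
    simp only [ENNReal.smul_def, smul_eq_mul]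
    exact ENNReal.add_ne_top.2 ⟨ENNReal.mul_ne_top ENNReal.coe_ne_top hp,
      ENNReal.mul_ne_top ENNReal.coe_ne_top hr⟩) h
  simp only [ENNReal.smul_def, smul_eq_mul] at h'
  rw [ENNReal.toReal_add (ENNReal.mul_ne_top ENNReal.coe_ne_top hp)
      (ENNReal.mul_ne_top ENNReal.coe_ne_top hr), ENNReal.toReal_mul, ENNReal.toReal_mul,
      ENNReal.coe_toReal, ENNReal.coe_toReal, hkc, hmc] at h'
  calc (α t).toReal * ((r : ℝ) - p)
      ≤ ((r - t) / (r - p) * (α p).toReal + (t - p) / (r - p) * (α r).toReal) * (r - p) :=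
        mul_le_mul_of_nonneg_right h' hd.le
    _ = _ := by field_simp

/-- A function of class `𝒞` is the supremum of its nondecreasing affine minorants. -/
theorem ClassC.exists_affine_minorant (hα : ClassC α) {t h : ℝ≥0} (hh : (h : ℝ≥0∞) < α t) :
    ∃ s : ℝ≥0, ∀ r, α r ≠ ∞ → (s : ℝ) * r + h ≤ s * t + (α r).toReal := by
  have ht : 0 < t := by
    rw [pos_iff_ne_zero]
    rintro rfl
    simp [hα.map_zero] at hh
  obtain ⟨q, hqt, hq⟩ : ∃ q < t, ∀ r, q < r → (h : ℝ≥0∞) < α r := by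
    obtain ⟨q, hqt, hq⟩ := exists_Ioc_subset_of_mem_nhds (hα.lsc t _ hh) ⟨0, ht⟩
    refine ⟨q, hqt, fun r hr => ?_⟩
    rcases le_total r t with hrt | hrt
    · exact hq ⟨hr, hrt⟩
    · exact hh.trans_le (hα.monotone hrt)
  have hqt' : (q : ℝ) < t := hqt
  -- Slopes of the chords to `(t, h)` from graph points on its left of height at most `h`. Such
  -- points have `p ≤ q`, which bounds the slopes even when `α t = ∞`; the supremum is the slope
  -- sought.
  set S : Set ℝ := {y | ∃ p < t, α p ≤ h ∧ y = (h - (α p).toReal) / ((t : ℝ) - p)} with hS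
  have hSb : BddAbove S := by
    refine ⟨h / (t - q), ?_⟩
    rintro y ⟨p, hpt, hp, rfl⟩
    have hpq : (p : ℝ) ≤ q := by
      by_contra hc
      exact (hq p (not_le.1 hc)).not_ge hp
    exact div_le_div₀ h.2 (sub_le_self _ ENNReal.toReal_nonneg) (by linarith) (by linarith)
  have h0 : (h : ℝ) / t ∈ S := ⟨0, ht, by simp [hα.map_zero], by simp [hα.map_zero]⟩
  have hs0 : 0 ≤ sSup S := le_trans (by positivity) (le_csSup hSb h0)
  refine ⟨⟨sSup S, hs0⟩, fun r hr => ?_⟩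
  change sSup S * r + h ≤ sSup S * t + (α r).toReal
  rcases le_or_gt r t with hrt | hrt
  · have hrt' : (r : ℝ) ≤ t := hrt
    rcases le_or_gt (α r) h with hrh | hrh
    · have hlt : r < t := lt_of_le_of_ne hrt (by rintro rfl; exact hh.not_ge hrh)
      have hlt' : (0 : ℝ) < t - r := sub_pos.2 hlt
      have := le_csSup hSb ⟨r, hlt, hrh, rfl⟩
      rw [div_le_iff₀ hlt'] at this
      linarith
    · have h1 : (h : ℝ) ≤ (α r).toReal := by
        have := ENNReal.toReal_mono hr hrh.le
        simpa using this
      nlinarith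
  · have hrt' : (0 : ℝ) < r - t := sub_pos.2 hrt
    have : sSup S ≤ ((α r).toReal - h) / (r - t) := by
      refine csSup_le ⟨_, h0⟩ ?_
      rintro y ⟨p, hpt, hp, rfl⟩
      have hpt' : (0 : ℝ) < t - p := sub_pos.2 hpt
      rw [div_le_div_iff₀ hpt' hrt']
      have h1 := hα.toReal_mul_sub_le hpt hrt hr
      have h2 : (h : ℝ) ≤ (α t).toReal := by
        have := ENNReal.toReal_mono (ne_top_of_le_ne_top hr (hα.monotone hrt.le)) hh.le
        simpa using this
      nlinarith
    rw [le_div_iff₀ hrt'] at this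
    linarith

theorem AssumptionA1.exists_pos (h : AssumptionA1 α) : ∃ s : ℝ≥0, 0 < s ∧ conj α s < ∞ := by
  obtain ⟨b, hb, hset⟩ := h
  obtain ⟨s, hs0, hsb⟩ := ENNReal.lt_iff_exists_nnreal_btwn.1 hb
  refine ⟨s, by exact_mod_cast hs0, ?_⟩
  have : s ∈ {s : ℝ≥0 | (s : ℝ≥0∞) < b} := hsb
  rwa [← hset] at this

/-- Finiteness of the conjugate at one `s > 0` forces linear growth: `s t ≤ conj α s + α t`. -/
theorem AssumptionA1.bddAbove_sublevel (h : AssumptionA1 α) {y : ℝ≥0∞} (hy : y ≠ ∞) :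
    BddAbove {t : ℝ≥0 | α t ≤ y} := by
  obtain ⟨s, hs, hc⟩ := h.exists_pos
  have hfin : conj α s + y ≠ ∞ := ENNReal.add_ne_top.2 ⟨hc.ne, hy⟩
  refine ⟨(conj α s + y).toNNReal / s, fun t ht => ?_⟩
  rw [le_div_iff₀ hs, ← ENNReal.coe_le_coe, ENNReal.coe_toNNReal hfin, mul_comm]
  have h1 : ((s * t : ℝ≥0) : ℝ≥0∞) - α t ≤ conj α s :=
    le_iSup (fun t : ℝ≥0 => ((s * t : ℝ≥0) : ℝ≥0∞) - α t) t
  rw [tsub_le_iff_right] at h1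
  exact h1.trans (by gcongr; exact ht)

theorem ClassC.map_inverse_le (hα : ClassC α) (h : AssumptionA1 α) {y : ℝ≥0∞} (hy : y ≠ ∞) :
    α (inverse α y) ≤ y :=
  (hα.isClosed_sublevel y).csSup_mem ⟨0, by simp [hα.map_zero]⟩ (h.bddAbove_sublevel hy)

/-- Beyond `α⁻¹(2)` the function `α` lies above the line through the origin of slope
`2 / α⁻¹(2)`. -/
theorem ClassC.le_inverse_or (hα : ClassC α) (h : AssumptionA1 α) {t : ℝ≥0} (ht : α t ≠ ∞) :
    t ≤ inverse α 2 ∨ 2 * (t : ℝ) ≤ inverse α 2 * (α t).toReal := by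
  rcases le_or_gt (α t) 2 with h2 | h2
  · exact Or.inl (le_csSup (h.bddAbove_sublevel (by simp)) h2)
  right
  lift α t to ℝ≥0 using ht with w hw
  have h2' : 2 < w := by exact_mod_cast h2
  have hw0 : w ≠ 0 := (zero_lt_two.trans h2').ne'
  have h1 := hα.map_mul_le (k := 2 / w) (div_le_one_of_le₀ h2'.le zero_le) t
  rw [← hw] at h1
  have h3 : ((2 / w : ℝ≥0) : ℝ≥0∞) * w = 2 := by
    rw [← ENNReal.coe_mul, div_mul_cancel₀ _ hw0]; rfl
  rw [h3] at h1
  have h4 : 2 / w * t ≤ inverse α 2 := le_csSup (h.bddAbove_sublevel (by simp)) h1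
  have h5 : 2 * t ≤ inverse α 2 * w := by
    rw [div_mul_eq_mul_div, div_le_iff₀ (pos_iff_ne_zero.2 hw0)] at h4
    exact h4
  simpa using (by exact_mod_cast h5 : 2 * (t : ℝ) ≤ inverse α 2 * w)

/-- Sublevel sets are closed, so points strictly below `d` suffice. This strictness later provides a
single `φ` and some slack in `M`. -/
theorem ClassC.extend_le_of_forall_lt (hα : ClassC α) {d y : ℝ≥0∞}
    (h : ∀ t : ℝ≥0, (t : ℝ≥0∞) < d → α t ≤ y) : extend α d ≤ y := by
  unfold extend
  split_ifs with hd
  · subst hd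
    exact iSup_le fun t => h t ENNReal.coe_lt_top
  · lift d to ℝ≥0 using hd
    rw [ENNReal.toNNReal_coe]
    rcases eq_or_ne d 0 with rfl | hd0
    · simp [hα.map_zero]
    have hsub : Iio d ⊆ {t | α t ≤ y} := fun t ht => h t (by exact_mod_cast ht)
    have := (hα.isClosed_sublevel y).closure_subset_iff.2 hsub
    rw [closure_Iio' ⟨0, pos_iff_ne_zero.2 hd0⟩] at this
    exact this self_mem_Iic

theorem ClassC.le_extend (hα : ClassC α) {d : ℝ≥0∞} {t : ℝ≥0} (h : (t : ℝ≥0∞) ≤ d) :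
    α t ≤ extend α d := by
  unfold extend
  split_ifs with hd
  · exact le_iSup α t
  · exact hα.monotone (by rwa [← ENNReal.coe_le_coe, ENNReal.coe_toNNReal hd])

/-- A supporting slope `s` with intercept `-A` satisfies the super-quadratic lower bound. -/
theorem SuperQuadratic.le_intercept {s₀ c s : ℝ≥0} (h : SuperQuadratic α s₀ c) {A : ℝ}
    (hA0 : 0 ≤ A) (hA : ∀ r, α r ≠ ∞ → (s : ℝ) * r ≤ A + (α r).toReal) :
    (c : ℝ) * s ^ 2 ≤ A ∨ (s₀ : ℝ) < s ∧ (c : ℝ) * s₀ * s ≤ A := by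
  obtain ⟨hs₀, hc, hq⟩ := h
  rcases le_or_gt s s₀ with hs | hs
  · left
    have h1 : conj α s ≤ ENNReal.ofReal A := by
      refine iSup_le fun r => ?_
      rw [tsub_le_iff_right]
      rcases eq_or_ne (α r) ∞ with hr | hr
      · simp [hr]
      rw [← ENNReal.ofReal_toReal hr, ← ENNReal.ofReal_add hA0 ENNReal.toReal_nonneg,
        ← ENNReal.ofReal_coe_nnreal]
      exact ENNReal.ofReal_le_ofReal (by simpa using hA r hr)
    have h2 := (hq s hs).trans h1
    rw [← ENNReal.ofReal_coe_nnreal, ENNReal.ofReal_le_ofReal_iff hA0] at h2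
    simpa using h2
  · right
    have hs' : (s₀ : ℝ) < s := hs
    have hs₀' : (0 : ℝ) < s₀ := hs₀
    have hs0 : (0 : ℝ) < s := hs₀'.trans hs'
    refine ⟨hs, ?_⟩
    have hB : 0 ≤ s₀ / s * A := by positivity
    -- Scaling the minorant by `s₀ / s ≤ 1` keeps it below `α` and gives it slope `s₀`.
    have h1 : conj α s₀ ≤ ENNReal.ofReal (s₀ / s * A) := by
      refine iSup_le fun r => ?_
      rw [tsub_le_iff_right]
      rcases eq_or_ne (α r) ∞ with hr | hr
      · simp [hr]
      rw [← ENNReal.ofReal_toReal hr, ← ENNReal.ofReal_add hB ENNReal.toReal_nonneg,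
        ← ENNReal.ofReal_coe_nnreal]
      refine ENNReal.ofReal_le_ofReal ?_
      have h3 := mul_le_mul_of_nonneg_left (hA r hr) (by positivity : (0 : ℝ) ≤ s₀ / s)
      have h4 : (s₀ / s : ℝ) * (s * r) = s₀ * r := by field_simp
      have h5 : (s₀ / s : ℝ) * (α r).toReal ≤ (α r).toReal :=
        mul_le_of_le_one_left ENNReal.toReal_nonneg ((div_le_one hs0).2 hs'.le)
      push_cast
      linarith
    have h2 := (hq s₀ le_rfl).trans h1
    rw [← ENNReal.ofReal_coe_nnreal, ENNReal.ofReal_le_ofReal_iff hB] at h2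
    push_cast at h2
    rw [div_mul_eq_mul_div, le_div_iff₀ hs0] at h2
    have h6 : (s₀ : ℝ) * (c * s₀ * s) ≤ s₀ * A := by linarith
    exact le_of_mul_le_mul_left h6 hs₀'

end Convex

end NormEntropy

end

noncomputable section

namespace NormEntropy

/-! ### Exponential moments and relative entropy. -/

section Exponential

theorem exp_le_one_add_add_sq_mul_exp_abs (v : ℝ) :
    Real.exp v ≤ 1 + v + v ^ 2 * Real.exp |v| := by
  have h := Complex.norm_exp_sub_sum_le_norm_mul_exp (v : ℂ) 2
  simp only [Finset.sum_range_succ, Finset.sum_range_zero, pow_zero, Nat.factorial, pow_one,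
    Complex.norm_real, Real.norm_eq_abs] at h
  have h2 : |Real.exp v - (1 + v)| ≤ |v| ^ 2 * Real.exp |v| := by
    rw [← Real.norm_eq_abs, ← Complex.norm_real]
    push_cast
    simpa using h
  rw [sq_abs] at h2
  linarith [le_abs_self (Real.exp v - (1 + v))]

/-- In the second alternative `|v| ≤ w / 2`: half of `exp w` bounds `exp |v|`, the other half
absorbs the square. -/
theorem sq_mul_exp_abs_le {v x w : ℝ} (hx1 : x ≤ 1) (hw : 0 ≤ w)
    (h : |v| ≤ x ∨ 2 * |v| ≤ x * w) :
    v ^ 2 * Real.exp |v| ≤ x ^ 2 * (Real.exp 1 - 2 + 2 * Real.exp w) := by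
  have hv := abs_nonneg v
  have hew : 1 ≤ Real.exp w := Real.one_le_exp hw
  have he : 2 ≤ Real.exp 1 := by linarith [Real.add_one_le_exp (1 : ℝ)]
  rw [← sq_abs v]
  rcases h with h | h
  · have h1 : Real.exp |v| ≤ Real.exp 1 := Real.exp_le_exp.2 (h.trans hx1)
    calc |v| ^ 2 * Real.exp |v| ≤ x ^ 2 * Real.exp 1 := by gcongr
      _ ≤ _ := by gcongr; linarith
  · have h1 : |v| ≤ x * (w / 2) := by linarith
    have h2 : |v| ≤ w / 2 := h1.trans (mul_le_of_le_one_left (by positivity) hx1)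
    have h3 : (w / 2) ^ 2 ≤ 2 * Real.exp (w / 2) := by
      have := Real.quadratic_le_exp_of_nonneg (x := w / 2) (by positivity)
      linarith
    calc |v| ^ 2 * Real.exp |v| ≤ (x * (w / 2)) ^ 2 * Real.exp (w / 2) := by gcongr
      _ = x ^ 2 * ((w / 2) ^ 2 * Real.exp (w / 2)) := by ring
      _ ≤ x ^ 2 * (2 * Real.exp (w / 2) * Real.exp (w / 2)) := by gcongr
      _ = x ^ 2 * (2 * Real.exp w) := by
        rw [mul_assoc, ← Real.exp_add, add_halves]
      _ ≤ _ := by gcongr; linarith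

/-- With `x = s β / K`, the two terms of the maximum in `m_α` give `√2 e x ≤ s √c √(1 - u)` and `√2
e x ≤ 3 u`. Squaring the first settles the quadratic case; multiplying both settles the linear one,
where `e ≥ 2.7` ensures `e + 2 ≤ 2 e² / 3`. -/
theorem quadratic_le_of_intercept {e β K s s₀ c u A : ℝ} (he : 2.7 ≤ e) (hβ : 0 ≤ β) (hs : 0 ≤ s)
    (hs₀ : 0 ≤ s₀) (hc : 0 < c) (hu0 : 0 < u) (hu1 : u < 1)
    (hK₁ : √2 * (e * (β / √(c * (1 - u)))) ≤ K) (hK₂ : √2 * (e * (1 / u)) ≤ K)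
    (hu : u / √(1 - u) ≤ s₀ * √c) (hsβ : s * β ≤ 3)
    (hA : c * s ^ 2 ≤ A ∨ c * s₀ * s ≤ A) : (e + 2) * (s * β / K) ^ 2 ≤ A := by
  have h1u : 0 < 1 - u := by linarith
  set q := √(1 - u) with hq
  set p := √c with hp
  have hp0 : 0 < p := Real.sqrt_pos.2 hc
  have hq0 : 0 < q := Real.sqrt_pos.2 h1u
  have hp2 : p ^ 2 = c := Real.sq_sqrt hc.le
  have hq2 : q ^ 2 = 1 - u := Real.sq_sqrt h1u.le
  have hq1 : q ≤ 1 := by nlinarith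
  set r := √2 with hr
  have hr0 : 0 < r := Real.sqrt_pos.2 two_pos
  have hr2 : r ^ 2 = 2 := Real.sq_sqrt zero_le_two
  rw [Real.sqrt_mul hc.le] at hK₁
  have hK0 : 0 < K := lt_of_lt_of_le (by positivity) hK₂
  have hK₁' : r * e * β ≤ K * (p * q) := by
    have : r * (e * (β / (p * q))) = r * e * β / (p * q) := by ring
    rw [this, div_le_iff₀ (by positivity)] at hK₁
    exact hK₁
  have hK₂' : r * e ≤ K * u := by
    have : r * (e * (1 / u)) = r * e / u := by ring
    rw [this, div_le_iff₀ hu0] at hK₂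
    exact hK₂
  rw [div_le_iff₀ hq0] at hu
  set x := s * β / K with hx
  have hx0 : 0 ≤ x := by positivity
  have hxK : x * K = s * β := by rw [hx]; field_simp
  have hx1 : r * e * x ≤ s * p * q := by
    refine le_of_mul_le_mul_right ?_ hK0
    calc r * e * x * K = s * (r * e * β) := by rw [mul_assoc, hxK]; ring
      _ ≤ s * (K * (p * q)) := by gcongr
      _ = _ := by ring
  have hx2 : r * e * x ≤ 3 * u := by
    calc r * e * x ≤ K * u * x := by gcongr
      _ = u * (x * K) := by ring
      _ ≤ 3 * u := by rw [hxK]; nlinarith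
  rcases hA with hA | hA
  · calc (e + 2) * x ^ 2 ≤ (r * e * x) ^ 2 := by
          rw [mul_pow, mul_pow, hr2]
          gcongr
          norm_num at he
          nlinarith
      _ ≤ (s * p * q) ^ 2 := by gcongr
      _ = c * s ^ 2 * q ^ 2 := by rw [← hp2]; ring
      _ ≤ c * s ^ 2 * 1 := by gcongr; nlinarith
      _ ≤ A := by linarith
  · calc (e + 2) * x ^ 2 ≤ (r * e * x) * (r * e * x) / 3 := by
          have : (r * e * x) * (r * e * x) / 3 = r ^ 2 * e ^ 2 / 3 * x ^ 2 := by ring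
          rw [this, hr2]
          gcongr
          norm_num at he
          nlinarith
      _ ≤ (3 * u) * (s * p * q) / 3 := by gcongr
      _ = s * p * (u * q) := by ring
      _ ≤ s * p * (s₀ * p) := by
        refine mul_le_mul_of_nonneg_left ?_ (by positivity)
        calc u * q ≤ s₀ * p * q * q := by gcongr
          _ = s₀ * p * (q * q) := by ring
          _ ≤ s₀ * p := mul_le_of_le_one_right (by positivity) (by nlinarith)
      _ = c * s₀ * s := by rw [← hp2]; ring
      _ ≤ A := hA

variable {X : Type*} [MeasurableSpace X] {μ : Measure X}

theorem integrable_exp_of_bounded [IsFiniteMeasure μ] {f : X → ℝ} (hf : Measurable f) {C : ℝ}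
    (hC : ∀ x, |f x| ≤ C) : Integrable (fun x => Real.exp (f x)) μ :=
  Integrable.of_bound (by fun_prop) (Real.exp C) (ae_of_all _ fun x => by
    rw [Real.norm_eq_abs, Real.abs_exp]
    exact Real.exp_le_exp.2 ((le_abs_self _).trans (hC x)))

/-- The moment generating function of a centered bounded variable whose absolute value is
controlled by a variable with exponential moment at most `2`. -/
theorem integral_exp_mul_le [IsProbabilityMeasure μ] {Y w : X → ℝ} (hY : Measurable Y) {C : ℝ}
    (hC : ∀ x, |Y x| ≤ C) (hY0 : ∫ x, Y x ∂μ = 0) (hw0 : ∀ x, 0 ≤ w x)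
    (hw : Integrable (fun x => Real.exp (w x)) μ) (hw2 : ∫ x, Real.exp (w x) ∂μ ≤ 2)
    {β s A K : ℝ} (hβ0 : 0 ≤ β) (hs0 : 0 ≤ s) (hA0 : 0 ≤ A) (hK : 7 / 2 ≤ K)
    (hβ : ∀ᵐ x ∂μ, |Y x| ≤ β ∨ 2 * |Y x| ≤ β * w x) (hs : ∀ᵐ x ∂μ, s * |Y x| ≤ A + w x)
    (hsβ : s * β ≤ A + 2) (hsmall : s * β ≤ 3 → (Real.exp 1 + 2) * (s * β / K) ^ 2 ≤ A) :
    ∫ x, Real.exp (s / K * Y x) ∂μ ≤ Real.exp A := by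
  have hK0 : 0 < K := by linarith
  have hbd : ∀ x, |s / K * Y x| ≤ s / K * C := fun x => by
    rw [abs_mul, abs_of_nonneg (by positivity : 0 ≤ s / K)]
    gcongr
    exact hC x
  have hint := integrable_exp_of_bounded (μ := μ) (hY.const_mul (s / K)) hbd
  have hYint : Integrable Y μ := Integrable.of_bound hY.aestronglyMeasurable C (ae_of_all _ hC)
  rcases le_or_gt (s * β) 3 with h3 | h3
  · set x₀ := s * β / K with hx₀
    have hx0 : 0 ≤ x₀ := by positivity
    have hx1 : x₀ ≤ 1 := (div_le_one hK0).2 (by linarith)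
    have hpt : ∀ᵐ x ∂μ, Real.exp (s / K * Y x) ≤
        (1 + s / K * Y x) + x₀ ^ 2 * ((Real.exp 1 - 2) + 2 * Real.exp (w x)) := by
      filter_upwards [hβ] with x hx
      refine (exp_le_one_add_add_sq_mul_exp_abs _).trans (add_le_add le_rfl ?_)
      refine sq_mul_exp_abs_le hx1 (hw0 x) ?_
      rw [abs_mul, abs_of_nonneg (by positivity : 0 ≤ s / K)]
      refine hx.imp (fun h => ?_) (fun h => ?_)
      · calc s / K * |Y x| ≤ s / K * β := by gcongr
          _ = x₀ := by rw [hx₀]; ring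
      · calc 2 * (s / K * |Y x|) = s / K * (2 * |Y x|) := by ring
          _ ≤ s / K * (β * w x) := by gcongr
          _ = x₀ * w x := by rw [hx₀]; ring
    have hi1 : Integrable (fun x => 1 + s / K * Y x) μ :=
      (integrable_const _).add (hYint.const_mul _)
    have hi2 : Integrable (fun x => x₀ ^ 2 * ((Real.exp 1 - 2) + 2 * Real.exp (w x))) μ :=
      ((integrable_const _).add (hw.const_mul _)).const_mul _
    calc ∫ x, Real.exp (s / K * Y x) ∂μ
        ≤ ∫ x, (1 + s / K * Y x) + x₀ ^ 2 * ((Real.exp 1 - 2) + 2 * Real.exp (w x)) ∂μ :=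
          integral_mono_ae hint (hi1.add hi2) hpt
      _ = 1 + x₀ ^ 2 * ((Real.exp 1 - 2) + 2 * ∫ x, Real.exp (w x) ∂μ) := by
          rw [integral_add hi1 hi2, integral_add (integrable_const _) (hYint.const_mul _),
            integral_const_mul, hY0, integral_const_mul,
            integral_add (integrable_const _) (hw.const_mul _), integral_const_mul]
          simp
      _ ≤ 1 + x₀ ^ 2 * ((Real.exp 1 - 2) + 2 * 2) := by gcongr
      _ ≤ A + 1 := by linarith [hsmall h3]
      _ ≤ Real.exp A := Real.add_one_le_exp A
  -- Here `A > 1`. As `1 / K ≤ 2 / 7`, a factor `exp (5 A / 7)` remains to absorb the moment bound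
  -- 2, because `log 2 < 5 / 7`.
  · have hpt : ∀ᵐ x ∂μ, Real.exp (s / K * Y x) ≤ Real.exp (A / K) * Real.exp (w x) := by
      filter_upwards [hs] with x hx
      rw [← Real.exp_add]
      refine Real.exp_le_exp.2 ?_
      calc s / K * Y x ≤ s / K * |Y x| := by gcongr; exact le_abs_self _
        _ = s * |Y x| / K := by ring
        _ ≤ (A + w x) / K := by gcongr
        _ = A / K + w x / K := add_div _ _ _
        _ ≤ A / K + w x := by
          gcongr
          exact div_le_self (hw0 x) (by linarith)
    calc ∫ x, Real.exp (s / K * Y x) ∂μ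
        ≤ ∫ x, Real.exp (A / K) * Real.exp (w x) ∂μ := integral_mono_ae hint (hw.const_mul _) hpt
      _ ≤ Real.exp (A / K) * 2 := by rw [integral_const_mul]; gcongr
      _ ≤ Real.exp (A / K) * Real.exp (5 / 7 * A) := by
          gcongr
          have : Real.log 2 ≤ 5 / 7 * A := by linarith [Real.log_two_lt_d9]
          exact (Real.log_le_iff_le_exp two_pos).1 this
      _ ≤ Real.exp A := by
          rw [← Real.exp_add]
          refine Real.exp_le_exp.2 ?_
          have : A / K ≤ A / (7 / 2) := by gcongr
          linarith

/-- The easy half of the Donsker–Varadhan variational formula. -/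
theorem integral_le_klDiv_add_log [IsProbabilityMeasure μ] {ν : Measure X}
    [IsProbabilityMeasure ν] (hfin : InformationTheory.klDiv ν μ ≠ ∞) {f : X → ℝ}
    (hf : Measurable f) {C : ℝ} (hC : ∀ x, |f x| ≤ C) :
    ∫ x, f x ∂ν ≤ (InformationTheory.klDiv ν μ).toReal + Real.log (∫ x, Real.exp (f x) ∂μ) := by
  obtain ⟨hac, hint⟩ := InformationTheory.klDiv_ne_top_iff.1 hfin
  have hexp := integrable_exp_of_bounded (μ := μ) hf hC
  have hfν : Integrable f ν := Integrable.of_bound hf.aestronglyMeasurable C (ae_of_all _ hC)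
  have := isProbabilityMeasure_tilted hexp
  -- Gibbs' inequality for `ν` against `μ` tilted by `f`.
  have h1 := InformationTheory.integral_llr_add_sub_measure_univ_nonneg
    (hac.trans (absolutelyContinuous_tilted hexp))
    (integrable_llr_tilted_right hac hfν hint hexp)
  rw [integral_llr_tilted_right hac hfν hexp hint] at h1
  rw [InformationTheory.toReal_klDiv_of_measure_eq hac (by simp)]
  simp only [probReal_univ] at h1
  linarith

/-- The relative entropy of a conditional measure. -/
theorem klDiv_cond_le [IsProbabilityMeasure μ] {s : Set X} (hs : MeasurableSet s) (h0 : μ s ≠ 0) :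
    InformationTheory.klDiv (ProbabilityTheory.cond μ s) μ ≤
      ENNReal.ofReal (-Real.log (μ.real s)) := by
  have := ProbabilityTheory.cond_isProbabilityMeasure h0
  have hac : ProbabilityTheory.cond μ s ≪ μ := ProbabilityTheory.cond_absolutelyContinuous
  have hd : (ProbabilityTheory.cond μ s).rnDeriv μ =ᵐ[μ] fun x => (μ s)⁻¹ * s.indicator 1 x := by
    have h1 := Measure.rnDeriv_smul_left_of_ne_top (μ.restrict s) μ (ENNReal.inv_ne_top.2 h0)
    filter_upwards [h1, Measure.rnDeriv_restrict_self μ hs] with x hx1 hx2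
    rw [ProbabilityTheory.cond, hx1, Pi.smul_apply, hx2, smul_eq_mul]
  have hmem : ∀ᵐ x ∂ProbabilityTheory.cond μ s, x ∈ s := by
    refine Measure.ae_smul_measure ?_ _
    exact ae_restrict_mem hs
  have hllr : llr (ProbabilityTheory.cond μ s) μ =ᵐ[ProbabilityTheory.cond μ s]
      fun _ => -Real.log (μ.real s) := by
    filter_upwards [hac.ae_le hd, hmem] with x hx hxs
    rw [llr, hx, indicator_of_mem hxs]
    simp [Measure.real]
  rw [InformationTheory.klDiv_of_ac_of_integrable hac
    ((integrable_congr hllr).2 (integrable_const _)), integral_congr_ae hllr]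
  simp

end Exponential

end NormEntropy

end

noncomputable section

namespace NormEntropy

/-! ### The two implications between the entropy inequality and the Orlicz bound. -/

section Equivalence

variable {α : ℝ≥0 → ℝ≥0∞} {X : Type*} [MeasurableSpace X] {μ : Measure X}

theorem tau_add_one (α : ℝ≥0 → ℝ≥0∞) (t : ℝ≥0) :
    tau α t + 1 = EReal.exp ((α t : ℝ≥0∞) : EReal) :=
  tsub_add_cancel_of_le (EReal.one_le_exp_iff.2 (EReal.coe_ennreal_nonneg _))

theorem tau_add_one_of_ne_top {t : ℝ≥0} (h : α t ≠ ∞) :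
    tau α t + 1 = ENNReal.ofReal (Real.exp (α t).toReal) := by
  rw [tau_add_one, ← EReal.coe_ennreal_toReal h, EReal.exp_coe]

theorem tau_eq_top_iff {t : ℝ≥0} : tau α t = ∞ ↔ α t = ∞ := by
  simp [tau, ENNReal.sub_eq_top_iff]

theorem lt_tau_iff {t : ℝ≥0} {z : ℝ} (hz : 0 ≤ z) :
    ENNReal.ofReal z < tau α t ↔ ENNReal.ofReal (Real.log (1 + z)) < α t := by
  rcases eq_or_ne (α t) ∞ with h | h
  · simp [tau_eq_top_iff.2 h, h]
  have hl : 0 ≤ Real.log (1 + z) := Real.log_nonneg (by linarith)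
  rw [← ENNReal.add_lt_add_iff_right ENNReal.one_ne_top, tau_add_one_of_ne_top h,
    ← ENNReal.ofReal_one, ← ENNReal.ofReal_add hz zero_le_one,
    ENNReal.ofReal_lt_ofReal_iff (Real.exp_pos _), ENNReal.ofReal_lt_iff_lt_toReal hl h,
    Real.log_lt_iff_lt_exp (by linarith), add_comm]

theorem ClassC.measurable_tau (hα : ClassC α) : Measurable (tau α) := by
  have h1 : Measurable α := hα.monotone.measurable
  exact (EReal.measurable_exp.comp h1.coe_ereal_ennreal).sub_const 1

theorem exp_moment_of_lintegral_tau_le [IsProbabilityMeasure μ] (hα : ClassC α) {Y : X → ℝ≥0}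
    (hY : Measurable Y) (h : ∫⁻ x, tau α (Y x) ∂μ ≤ 1) :
    (∀ᵐ x ∂μ, α (Y x) ≠ ∞) ∧ Integrable (fun x => Real.exp (α (Y x)).toReal) μ ∧
      ∫ x, Real.exp (α (Y x)).toReal ∂μ ≤ 2 := by
  have hm : Measurable fun x => tau α (Y x) := hα.measurable_tau.comp hY
  have hfin : ∀ᵐ x ∂μ, α (Y x) ≠ ∞ := by
    filter_upwards [ae_lt_top hm (h.trans_lt ENNReal.one_lt_top).ne] with x hx
    exact fun hc => hx.ne (tau_eq_top_iff.2 hc)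
  have hmw : Measurable fun x => Real.exp (α (Y x)).toReal :=
    Real.measurable_exp.comp (hα.monotone.measurable.comp hY).ennreal_toReal
  have hl : ∫⁻ x, ENNReal.ofReal (Real.exp (α (Y x)).toReal) ∂μ ≤ 2 := by
    calc ∫⁻ x, ENNReal.ofReal (Real.exp (α (Y x)).toReal) ∂μ
        = ∫⁻ x, tau α (Y x) + 1 ∂μ := lintegral_congr_ae (by
          filter_upwards [hfin] with x hx
          exact (tau_add_one_of_ne_top hx).symm)
      _ = ∫⁻ x, tau α (Y x) ∂μ + 1 := by
          rw [lintegral_add_right _ measurable_const]; simp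
      _ ≤ 1 + 1 := by gcongr
      _ = 2 := one_add_one_eq_two
  refine ⟨hfin, ⟨hmw.aestronglyMeasurable, ?_⟩, ?_⟩
  · rw [hasFiniteIntegral_iff_ofReal (ae_of_all _ fun x => (Real.exp_pos _).le)]
    exact hl.trans_lt ENNReal.ofNat_lt_top
  · rw [integral_eq_lintegral_of_nonneg_ae (ae_of_all _ fun x => (Real.exp_pos _).le)
      hmw.aestronglyMeasurable]
    have := ENNReal.toReal_mono ENNReal.ofNat_ne_top hl
    simpa using this

/-- If the entropy `H` were below some `h < α t`, a minorant with `A = s t - h` would give `s t ≤ H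
+ A < s t` through Donsker–Varadhan. -/
theorem le_klDiv_of_lintegral_tau_le [IsProbabilityMeasure μ] (hα : ClassC α)
    (hA1 : AssumptionA1 α) {s₀ c : ℝ≥0} (hq : SuperQuadratic α s₀ c) {u : ℝ} (hu0 : 0 < u)
    (hu1 : u < 1) (hu : u / √(1 - u) ≤ s₀ * √(c : ℝ)) {f : X → ℝ} (hf : Measurable f) {C : ℝ}
    (hC : ∀ x, |f x| ≤ C) (hf0 : ∫ x, f x ∂μ = 0) {l : ℝ≥0} (hl : 0 < l)
    (hτ : ∫⁻ x, tau α (‖f x‖₊ / l) ∂μ ≤ 1) {ν : Measure X} [IsProbabilityMeasure ν] {t : ℝ≥0}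
    (ht : (t : ℝ) * (√2 * mConst α c u * l) ≤ ∫ x, f x ∂ν) :
    α t ≤ InformationTheory.klDiv ν μ := by
  by_contra! hlt
  obtain ⟨h, hh1, hh2⟩ := ENNReal.lt_iff_exists_nnreal_btwn.1 hlt
  obtain ⟨s, hs⟩ := hα.exists_affine_minorant hh2
  set A : ℝ := s * t - h with hA
  have hA0 : 0 ≤ A := by
    have := hs 0 (by simp [hα.map_zero])
    simp [hα.map_zero] at this
    linarith
  have hsA : ∀ r, α r ≠ ∞ → (s : ℝ) * r ≤ A + (α r).toReal := fun r hr => by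
    linarith [hs r hr]
  have hl' : (0 : ℝ) < l := hl
  set β := inverse α 2 with hβ
  set K : ℝ := √2 * mConst α c u with hK
  have he : 2.7 ≤ Real.exp 1 := by
    have := Real.exp_one_gt_d9
    norm_num at this ⊢
    linarith
  have hr2 : (1.4 : ℝ) ≤ √2 := Real.le_sqrt_of_sq_le (by norm_num)
  have hK₁ : √2 * (Real.exp 1 * ((β : ℝ) / √((c : ℝ) * (1 - u)))) ≤ K := by
    rw [hK, mConst]
    gcongr
    exact le_max_left _ _
  have hK₂ : √2 * (Real.exp 1 * (1 / u)) ≤ K := by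
    rw [hK, mConst]
    gcongr
    exact le_max_right _ _
  have hK3 : 7 / 2 ≤ K := by
    have h1 : 1 ≤ 1 / u := (one_le_div hu0).2 hu1.le
    calc (7 / 2 : ℝ) ≤ 1.4 * (2.7 * 1) := by norm_num
      _ ≤ √2 * (Real.exp 1 * (1 / u)) := by gcongr
      _ ≤ K := hK₂
  have hK0 : 0 < K := by linarith
  have hYm : Measurable fun x => ‖f x‖₊ / l := hf.nnnorm.div_const l
  obtain ⟨hfin, hwi, hw2⟩ := exp_moment_of_lintegral_tau_le hα hYm hτ
  have habs : ∀ x, |f x / l| = ((‖f x‖₊ / l : ℝ≥0) : ℝ) := fun x => by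
    rw [abs_div, abs_of_pos hl', NNReal.coe_div, coe_nnnorm, Real.norm_eq_abs]
  have hmgf : ∫ x, Real.exp (s / K * (f x / l)) ∂μ ≤ Real.exp A := by
    refine integral_exp_mul_le (w := fun x => (α (‖f x‖₊ / l)).toReal) (C := C / l) (β := β)
      (hf.div_const _) (fun x => ?_) ?_ (fun x => ENNReal.toReal_nonneg) hwi hw2 β.2 s.2 hA0 hK3
      ?_ ?_ ?_ ?_
    · rw [abs_div, abs_of_pos hl']
      gcongr
      exact hC x
    · rw [integral_div, hf0, zero_div]
    · filter_upwards [hfin] with x hx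
      rw [habs]
      exact hα.le_inverse_or hA1 hx
    · filter_upwards [hfin] with x hx
      rw [habs]
      exact hsA _ hx
    -- The minorant evaluated at `β` gives `s β ≤ A + 2`.
    · have h2 : α β ≤ 2 := hα.map_inverse_le hA1 (by simp)
      have h3 := hsA β (ne_top_of_le_ne_top (by simp) h2)
      have h4 := ENNReal.toReal_mono (by simp) h2
      simp only [ENNReal.toReal_ofNat] at h4
      linarith
    · intro h3
      exact quadratic_le_of_intercept he β.2 s.2 s₀.2 hq.2.1 hu0 hu1 hK₁ hK₂ hu h3
        ((hq.le_intercept hA0 hsA).imp_right And.right)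
  have hgm : Measurable fun x => s / K * (f x / l) := (hf.div_const _).const_mul _
  have hgC : ∀ x, |s / K * (f x / l)| ≤ s / K * (C / l) := fun x => by
    rw [abs_mul, abs_of_nonneg (by positivity : 0 ≤ s / K), abs_div, abs_of_pos hl']
    gcongr
    exact hC x
  have hdv := integral_le_klDiv_add_log (hlt.trans_le le_top).ne hgm hgC
  have hlog : Real.log (∫ x, Real.exp (s / K * (f x / l)) ∂μ) ≤ A :=
    (Real.log_le_iff_le_exp (integral_exp_pos (integrable_exp_of_bounded hgm hgC))).2 hmgf
  have hH : (InformationTheory.klDiv ν μ).toReal < h := by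
    simpa using (ENNReal.toReal_lt_toReal (hlt.trans_le le_top).ne ENNReal.coe_ne_top).2 hh1
  rw [integral_const_mul, integral_div] at hdv
  have hst : (s : ℝ) * t ≤ s / K * ((∫ x, f x ∂ν) / l) := by
    calc (s : ℝ) * t = s / K * (t * (K * l) / l) := by field_simp
      _ ≤ s / K * ((∫ x, f x ∂ν) / l) := by gcongr
  linarith

theorem mConst_pos (α : ℝ≥0 → ℝ≥0∞) (c : ℝ≥0) {u : ℝ} (hu : 0 < u) : 0 < mConst α c u :=
  mul_pos (Real.exp_pos _) (lt_max_of_lt_right (by positivity))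

theorem OrliczBound.normEntropyInequality [IsProbabilityMeasure μ] {Φ : Set (X → ℝ)}
    (hΦ : IsSymmetricBoundedClass Φ) (hα : ClassC α) (hA1 : AssumptionA1 α) {M : ℝ} (hM : 0 < M)
    (h : OrliczBound α Φ μ M) {s₀ c : ℝ≥0} (hq : SuperQuadratic α s₀ c) {u : ℝ} (hu0 : 0 < u)
    (hu1 : u < 1) (hu : u / √(1 - u) ≤ s₀ * √(c : ℝ)) :
    NormEntropyInequality α Φ μ (√2 * mConst α c u * M) := by
  intro ν hν
  have hK : 0 < √2 * mConst α c u := mul_pos (by positivity) (mConst_pos α c hu0)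
  set K := √2 * mConst α c u
  refine hα.extend_le_of_forall_lt fun t ht => ?_
  have hKM : 0 < K * M := mul_pos hK hM
  rw [ENNReal.lt_div_iff_mul_lt (by simp [hKM]) (by simp), ← ENNReal.ofReal_coe_nnreal,
    ← ENNReal.ofReal_mul t.coe_nonneg] at ht
  obtain ⟨φ, hφ⟩ := lt_iSup_iff.1 ht
  obtain ⟨hφΦ, hφ⟩ := lt_iSup_iff.1 hφ
  set D := ∫ x, φ x ∂ν - ∫ x, φ x ∂μ with hD
  have htD : (t : ℝ) * (K * M) < D := (ENNReal.ofReal_lt_ofReal_iff_of_nonneg (by positivity)).1 hφ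
  have hD0 : 0 < D := lt_of_le_of_lt (by positivity) htD
  -- The strict inequality `t K M < D` leaves room for `M' > M`, hence for an admissible `l` below
  -- `M'` even if the infimum in the norm is not attained.
  obtain ⟨M', hMM', hM'⟩ : ∃ M', M < M' ∧ (t : ℝ) * (K * M') ≤ D := by
    rcases eq_or_ne t 0 with rfl | ht0
    · exact ⟨M + 1, by linarith, by simpa using hD0.le⟩
    · have ht0' : 0 < (t : ℝ) := NNReal.coe_pos.2 (pos_iff_ne_zero.2 ht0)
      refine ⟨D / (t * K), ?_, ?_⟩
      · rw [lt_div_iff₀ (by positivity)]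
        linarith
      · apply le_of_eq
        field_simp
  obtain ⟨C, hC⟩ := hΦ.bounded φ hφΦ
  have hφm := hΦ.measurable φ hφΦ
  have hint : ∀ ρ : Measure X, IsProbabilityMeasure ρ → Integrable φ ρ := fun ρ _ =>
    Integrable.of_bound hφm.aestronglyMeasurable C (ae_of_all _ hC)
  have hlux : luxemburgNorm α μ (fun x => φ x - ∫ y, φ y ∂μ) < ENNReal.ofReal M' :=
    (h φ hφΦ).trans_lt ((ENNReal.ofReal_lt_ofReal_iff (hM.trans hMM')).2 hMM')
  obtain ⟨l, hl⟩ := iInf_lt_iff.1 hlux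
  obtain ⟨⟨hl0, hτ⟩, hl⟩ := iInf_lt_iff.1 hl
  have hlM : (l : ℝ) ≤ M' := by
    rw [← ENNReal.ofReal_coe_nnreal] at hl
    exact ((ENNReal.ofReal_lt_ofReal_iff (hM.trans hMM')).1 hl).le
  refine le_klDiv_of_lintegral_tau_le hα hA1 hq hu0 hu1 hu (hφm.sub_const _)
    (C := C + |∫ y, φ y ∂μ|) (fun x => ?_) ?_ hl0 hτ ?_
  · exact (abs_sub _ _).trans (by gcongr; exact hC x)
  · rw [integral_sub (hint μ inferInstance) (integrable_const _)]
    simp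
  · rw [integral_sub (hint ν hν) (integrable_const _)]
    simp only [integral_const, probReal_univ, one_smul]
    refine le_trans ?_ hM'
    gcongr

/-- One-sided deviation bound, obtained by testing the norm-entropy inequality on a conditional
measure. -/
theorem NormEntropyInequality.measureReal_le [IsProbabilityMeasure μ] {Φ : Set (X → ℝ)}
    (hΦ : IsSymmetricBoundedClass Φ) (hα : ClassC α) {a : ℝ≥0} (ha : 0 < a)
    (h : NormEntropyInequality α Φ μ a) {φ : X → ℝ} (hφ : φ ∈ Φ) {y : ℝ} (hy : 0 ≤ y) :
    μ.real {x | 0 ≤ φ x - ∫ z, φ z ∂μ ∧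
      ENNReal.ofReal y < α ((φ x - ∫ z, φ z ∂μ).toNNReal / a)} ≤ Real.exp (-y) := by
  obtain ⟨C, hC⟩ := hΦ.bounded φ hφ
  have hφm := hΦ.measurable φ hφ
  set m := ∫ z, φ z ∂μ with hm
  set s := {x | 0 ≤ φ x - m ∧ ENNReal.ofReal y < α ((φ x - m).toNNReal / a)} with hs
  have hsm : MeasurableSet s := by
    refine (measurableSet_le measurable_const (hφm.sub_const _)).inter ?_
    exact measurableSet_lt measurable_const
      (hα.monotone.measurable.comp ((hφm.sub_const _).real_toNNReal.div_const _))
  rcases eq_or_ne (μ s) 0 with h0 | h0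
  · simp [Measure.real, h0, (Real.exp_pos _).le]
  have hpos : 0 < μ.real s := ENNReal.toReal_pos h0 (measure_ne_top _ _)
  have hprob := ProbabilityTheory.cond_isProbabilityMeasure h0
  have hint : ∀ ρ : Measure X, IsProbabilityMeasure ρ → Integrable φ ρ := fun ρ _ =>
    Integrable.of_bound hφm.aestronglyMeasurable C (ae_of_all _ hC)
  -- Some point of `s` has `φ x` at most the conditional mean, so monotonicity of `α` carries the
  -- defining bound of `s` over to the mean.
  obtain ⟨x, hxs, hx⟩ := exists_le_setAverage h0 (measure_ne_top μ s)
    (hint μ inferInstance).integrableOn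
  have hx' : φ x ≤ ∫ z, φ z ∂ProbabilityTheory.cond μ s := by
    refine hx.trans (le_of_eq ?_)
    rw [average, Measure.restrict_apply_univ]
    rfl
  have h0' : ENNReal.ofReal (φ x - m) ≤ dualNorm Φ (ProbabilityTheory.cond μ s) μ := by
    refine le_trans (ENNReal.ofReal_le_ofReal (sub_le_sub_right hx' m)) ?_
    exact le_iSup₂ (f := fun (φ : X → ℝ) (_ : φ ∈ Φ) => ENNReal.ofReal
      (∫ x, φ x ∂ProbabilityTheory.cond μ s - ∫ x, φ x ∂μ)) φ hφ
  have h1 : (((φ x - m).toNNReal / a : ℝ≥0) : ℝ≥0∞) ≤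
      dualNorm Φ (ProbabilityTheory.cond μ s) μ / ENNReal.ofReal a := by
    rw [ENNReal.coe_div ha.ne', ENNReal.ofReal_coe_nnreal]
    exact ENNReal.div_le_div_right h0' _
  have h2 := (hxs.2.trans_le (hα.le_extend h1)).trans_le
    ((h _ hprob).trans (klDiv_cond_le hsm h0))
  rw [ENNReal.ofReal_lt_ofReal_iff_of_nonneg hy] at h2
  rw [← Real.log_le_iff_le_exp hpos]
  linarith

theorem ClassC.three_mul_map_div_le (hα : ClassC α) (t a : ℝ≥0) :
    3 * α (t / (3 * a)) ≤ α (t / a) := by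
  have h := hα.map_mul_le (k := 3⁻¹) (inv_le_one_of_one_le₀ (by norm_num)) (t / a)
  have h2 : (3⁻¹ : ℝ≥0) * (t / a) = t / (3 * a) := by
    rw [mul_comm 3 a, ← div_div]; ring
  rw [h2] at h
  calc 3 * α (t / (3 * a)) ≤ 3 * (((3⁻¹ : ℝ≥0) : ℝ≥0∞) * α (t / a)) := by gcongr
    _ = α (t / a) := by
      rw [← mul_assoc, ENNReal.coe_inv (by norm_num)]
      norm_num [ENNReal.mul_inv_cancel]

/-- The factor 3 turns the level `log (1 + z)` into `3 log (1 + z)`, hence the cube; the 2 counts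
the signs `φ` and `-φ`. -/
theorem NormEntropyInequality.measureReal_tau_le [IsProbabilityMeasure μ] {Φ : Set (X → ℝ)}
    (hΦ : IsSymmetricBoundedClass Φ) (hα : ClassC α) {a : ℝ≥0} (ha : 0 < a)
    (h : NormEntropyInequality α Φ μ a) {φ : X → ℝ} (hφ : φ ∈ Φ) {z : ℝ} (hz : 0 ≤ z) :
    μ.real {x | ENNReal.ofReal z < tau α (‖φ x - ∫ y, φ y ∂μ‖₊ / (3 * a))} ≤
      2 * ((1 + z) ^ 3)⁻¹ := by
  set y := 3 * Real.log (1 + z) with hy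
  have hl : 0 ≤ Real.log (1 + z) := Real.log_nonneg (by linarith)
  have hy0 : 0 ≤ y := by positivity
  have hexp : Real.exp (-y) = ((1 + z) ^ 3)⁻¹ := by
    rw [Real.exp_neg, hy, mul_comm, Real.exp_mul, Real.exp_log (by linarith)]
    norm_cast
  have hp := h.measureReal_le hΦ hα ha hφ hy0
  have hn := h.measureReal_le hΦ hα ha (hΦ.symmetric φ hφ) hy0
  rw [hexp] at hp hn
  refine le_trans (measureReal_mono ?_) ((measureReal_union_le _ _).trans
    ((add_le_add hp hn).trans (two_mul _).ge))
  intro x hx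
  have h1 : ENNReal.ofReal y < α (‖φ x - ∫ y, φ y ∂μ‖₊ / a) := by
    refine lt_of_lt_of_le ?_ (hα.three_mul_map_div_le _ a)
    rw [hy, ENNReal.ofReal_mul (by norm_num)]
    have h2 := (lt_tau_iff hz).1 hx
    have h3 : ENNReal.ofReal 3 = 3 := by simp
    rw [h3]
    exact (ENNReal.mul_lt_mul_iff_right (by norm_num) (by norm_num)).2 h2
  simp only [Pi.neg_apply, integral_neg]
  rcases le_total 0 (φ x - ∫ y, φ y ∂μ) with h0 | h0
  · refine Or.inl ⟨h0, ?_⟩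
    rwa [Real.toNNReal_eq_nnnorm_of_nonneg h0]
  · refine Or.inr ⟨by simp only [sub_neg_eq_add]; linarith, ?_⟩
    rw [show -φ x - -∫ y, φ y ∂μ = -(φ x - ∫ y, φ y ∂μ) by ring,
      Real.toNNReal_eq_nnnorm_of_nonneg (neg_nonneg.2 h0), nnnorm_neg]
    exact h1

/-- This fixes the constant 3: with exponent `k > 1` the integral would be `2 / (k - 1)`. -/
theorem lintegral_two_mul_inv_cube :
    ∫⁻ z in Ioi (0 : ℝ), ENNReal.ofReal (2 * ((1 + z) ^ 3)⁻¹) = 1 := by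
  have hd : ∀ z ∈ Ici (0 : ℝ),
      HasDerivAt (fun z : ℝ => -((1 + z) ^ 2)⁻¹) (2 * ((1 + z) ^ 3)⁻¹) z := by
    intro z hz
    have hz' : 1 + z ≠ 0 := by
      have : (0 : ℝ) ≤ z := hz
      positivity
    have h1 := ((((hasDerivAt_id z).const_add 1).pow 2).inv (pow_ne_zero 2 hz')).neg
    refine h1.congr_deriv ?_
    simp only [id, Nat.cast_ofNat]
    field_simp
    norm_num
    ring
  have hnn : ∀ z ∈ Ioi (0 : ℝ), 0 ≤ 2 * ((1 + z) ^ 3)⁻¹ := by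
    intro z hz
    have : (0 : ℝ) < z := hz
    positivity
  have hlim : Filter.Tendsto (fun z : ℝ => -((1 + z) ^ 2)⁻¹) Filter.atTop (nhds 0) := by
    rw [← neg_zero]
    refine (Filter.Tendsto.inv_tendsto_atTop ?_).neg
    exact (Filter.tendsto_pow_atTop two_ne_zero).comp
      (Filter.tendsto_atTop_add_const_left _ 1 Filter.tendsto_id)
  rw [← ofReal_integral_eq_lintegral_ofReal (integrableOn_Ioi_deriv_of_nonneg' hd hnn hlim)
    ((ae_restrict_iff' measurableSet_Ioi).2 (ae_of_all _ hnn)),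
    integral_Ioi_of_hasDerivAt_of_nonneg' hd hnn hlim]
  simp

theorem NormEntropyInequality.lintegral_tau_le [IsProbabilityMeasure μ] {Φ : Set (X → ℝ)}
    (hΦ : IsSymmetricBoundedClass Φ) (hα : ClassC α) {a : ℝ≥0} (ha : 0 < a)
    (h : NormEntropyInequality α Φ μ a) {φ : X → ℝ} (hφ : φ ∈ Φ) :
    ∫⁻ x, tau α (‖φ x - ∫ y, φ y ∂μ‖₊ / (3 * a)) ∂μ ≤ 1 := by
  set T : X → ℝ≥0∞ := fun x => tau α (‖φ x - ∫ y, φ y ∂μ‖₊ / (3 * a)) with hT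
  have hTm : Measurable T :=
    hα.measurable_tau.comp (((hΦ.measurable φ hφ).sub_const _).nnnorm.div_const _)
  have htail : ∀ z : ℝ, 0 ≤ z → μ.real {x | ENNReal.ofReal z < T x} ≤ 2 * ((1 + z) ^ 3)⁻¹ :=
    fun z hz => h.measureReal_tau_le hΦ hα ha hφ hz
  -- The layer-cake formula is applied to a real-valued function, so `T = ∞` is first shown null by
  -- letting `z → ∞` in the tail bound.
  have hfin : ∀ᵐ x ∂μ, T x ≠ ∞ := by
    have hle : ∀ n : ℕ, μ.real {x | T x = ∞} ≤ 2 * ((1 + (n : ℝ)) ^ 3)⁻¹ := fun n => by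
      refine le_trans (measureReal_mono fun x hx => ?_) (htail n n.cast_nonneg)
      have hx' : T x = ∞ := hx
      simp [hx']
    have hlim : Filter.Tendsto (fun n : ℕ => 2 * ((1 + (n : ℝ)) ^ 3)⁻¹) Filter.atTop
        (nhds (2 * 0)) := by
      refine (Filter.Tendsto.inv_tendsto_atTop ?_).const_mul 2
      exact (Filter.tendsto_pow_atTop three_ne_zero).comp
        (Filter.tendsto_atTop_add_const_left _ 1 tendsto_natCast_atTop_atTop)
    have h0 := ge_of_tendsto' hlim hle
    rw [mul_zero] at h0
    have h1 := le_antisymm h0 measureReal_nonneg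
    rw [measureReal_eq_zero_iff] at h1
    rw [ae_iff]
    simpa using h1
  calc ∫⁻ x, T x ∂μ = ∫⁻ x, ENNReal.ofReal (T x).toReal ∂μ := lintegral_congr_ae (by
        filter_upwards [hfin] with x hx
        rw [ENNReal.ofReal_toReal hx])
    _ = ∫⁻ z in Ioi (0 : ℝ), μ {x | z < (T x).toReal} :=
        lintegral_eq_lintegral_meas_lt μ (ae_of_all _ fun x => ENNReal.toReal_nonneg)
          hTm.ennreal_toReal.aemeasurable
    _ ≤ ∫⁻ z in Ioi (0 : ℝ), ENNReal.ofReal (2 * ((1 + z) ^ 3)⁻¹) := by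
        refine setLIntegral_mono' measurableSet_Ioi fun z hz => ?_
        have hz' : (0 : ℝ) < z := hz
        rw [← ofReal_measureReal]
        refine ENNReal.ofReal_le_ofReal (le_trans (measureReal_mono fun x hx => ?_)
          (htail z hz'.le))
        exact (ENNReal.ofReal_lt_ofReal_iff_of_nonneg hz'.le).2 hx |>.trans_le
          ENNReal.ofReal_toReal_le
    _ = 1 := lintegral_two_mul_inv_cube

theorem NormEntropyInequality.orliczBound [IsProbabilityMeasure μ] {Φ : Set (X → ℝ)}
    (hΦ : IsSymmetricBoundedClass Φ) (hα : ClassC α) {a : ℝ} (ha : 0 < a)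
    (h : NormEntropyInequality α Φ μ a) : OrliczBound α Φ μ (3 * a) := by
  lift a to ℝ≥0 using ha.le
  intro φ hφ
  have ha' : 0 < a := by exact_mod_cast ha
  have h1 := h.lintegral_tau_le hΦ hα ha' hφ
  refine (iInf₂_le (3 * a) ⟨by positivity, h1⟩).trans (le_of_eq ?_)
  rw [← ENNReal.ofReal_coe_nnreal]
  push_cast
  rfl

end Equivalence

end NormEntropy

end

theorem mainTheorem1 {X : Type*} [TopologicalSpace X] [PolishSpace X]
    [MeasurableSpace X] [BorelSpace X]
    (μ : Measure X) [IsProbabilityMeasure μ]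
    (Φ : Set (X → ℝ)) (hΦ : NormEntropy.IsSymmetricBoundedClass Φ)
    (α : ℝ≥0 → ℝ≥0∞) (hα : NormEntropy.ClassC α)
    (hA1 : NormEntropy.AssumptionA1 α) (hA2 : NormEntropy.AssumptionA2 α) :
    ((∃ a : ℝ, 0 < a ∧ NormEntropy.NormEntropyInequality α Φ μ a) ↔
      (∃ M : ℝ, 0 < M ∧ NormEntropy.OrliczBound α Φ μ M)) ∧
    (∀ a : ℝ, 0 < a → NormEntropy.NormEntropyInequality α Φ μ a →
      NormEntropy.OrliczBound α Φ μ (3 * a)) ∧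
    (∀ M : ℝ, 0 < M → NormEntropy.OrliczBound α Φ μ M →
      ∀ s₀ c : ℝ≥0, NormEntropy.SuperQuadratic α s₀ c →
      ∀ u : ℝ, 0 < u → u < 1 → u / √(1 - u) ≤ (s₀ : ℝ) * √(c : ℝ) → u ^ 3 / (1 - u) ≤ 2 →
        NormEntropy.NormEntropyInequality α Φ μ (√2 * NormEntropy.mConst α c u * M)) := by
  refine ⟨⟨?_, ?_⟩, fun a ha h => h.orliczBound hΦ hα ha, fun M hM h s₀ c hq u hu0 hu1 hu _ =>
    h.normEntropyInequality hΦ hα hA1 hM hq hu0 hu1 hu⟩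
  · rintro ⟨a, ha, h⟩
    exact ⟨3 * a, by positivity, h.orliczBound hΦ hα ha⟩
  · rintro ⟨M, hM, h⟩
    obtain ⟨s₀, c, hq⟩ := hA2
    have hs₀ : (0 : ℝ) < s₀ := hq.1
    have hc : (0 : ℝ) < c := hq.2.1
    -- Since `u ≤ 1 / 2` gives `√(1 - u) ≥ 1 / 2`, it follows that `u / √(1 - u) ≤ 2 u ≤ s₀ √c`.
    set u : ℝ := min (1 / 2) (s₀ * √(c : ℝ) / 2) with hu
    have hu0 : 0 < u := lt_min (by norm_num) (by positivity)
    have hu2 : u ≤ 1 / 2 := min_le_left _ _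
    have hu3 : u ≤ s₀ * √(c : ℝ) / 2 := min_le_right _ _
    have hsq : 1 / 2 ≤ √(1 - u) := Real.le_sqrt_of_sq_le (by norm_num; linarith)
    refine ⟨√2 * NormEntropy.mConst α c u * M, ?_,
      h.normEntropyInequality hΦ hα hA1 hM hq hu0 (by linarith) ?_⟩
    · have := NormEntropy.mConst_pos α c hu0
      positivity
    · calc u / √(1 - u) ≤ u / (1 / 2) := by gcongr
        _ ≤ s₀ * √(c : ℝ) := by linarith
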